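/- Let $\mathcal H_A$ and $\mathcal H_B$ be finite-dimensional complex Hilbert spaces of arbitrary dimension, let $\rho_{AB}$ be a state (positive semidefinite operator of trace one) and $H_{AB}$ a Hamiltonian (Hermitian operator) on $\mathcal H_A\otimes\mathcal H_B$. The pair is called CPTP-local passive (the state is CPTP-local passive with respect to the Hamiltonian) if no energy can be extracted by a completely positive trace-preserving (CPTP) map on $A$ alone, i.e. if $$\max_{\mathcal E}\Big(\mathrm{Tr}[H_{AB}\,\rho_{AB}]-\mathrm{Tr}\big[H_{AB}\,(\mathcal E\otimes \mathrm{id}_B)(\rho_{AB})\big]\Big)=0,$$ where $\mathcal E$ ranges over all CPTP maps from the operators on $\mathcal H_A$ to themselves. Theorem. If $\rho_{AB}$ is CPTP-local passive with respect to $H_{AB}$, then for every positive integer $n$ the state $\rho_{AB}^{\otimes n}$, regarded as a state of the bipartite system $A_1\cdots A_n : B_1\cdots B_n$, is CPTP-local passive (with respect to arbitrary, possibly joint, CPTP maps on $A_1\cdots A_n$) with respect to the non-interacting Hamiltonian $$\sum_n H = H\otimes I^{\otimes(n-1)}+I\otimes H\otimes I^{\otimes(n-2)}+\cdots+I^{\otimes(n-1)}\otimes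 H .$$ -/

import Mathlib

open scoped ComplexOrder

/-! Finite-dimensional quantum systems are described in a fixed orthonormal basis: an operator on
the Hilbert space with basis indexed by the finite type `α` is a `Matrix α α ℂ`, and the composite
system `AB` has the index type `α × β`. -/

/-- A state (density operator): positive semidefinite of trace one. -/
structure IsState {ι : Type*} [Fintype ι] (ρ : Matrix ι ι ℂ) : Prop where
  posSemidef : ρ.PosSemidef
  trace_eq_one : ρ.trace = 1

/-- The operator `(Φ ⊗ id_B) X`: the map `Φ` acts on each of the `A`-blocks
`⟨k|_B X |l⟩_B` of `X`, so that `(Φ ⊗ id_B) (S ⊗ T) = Φ S ⊗ T`. -/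
def applyLocal {α β : Type*} (Φ : Matrix α α ℂ →ₗ[ℂ] Matrix α α ℂ)
    (X : Matrix (α × β) (α × β) ℂ) : Matrix (α × β) (α × β) ℂ :=
  Matrix.of fun p q => Φ (Matrix.of fun i j => X (i, p.2) (j, q.2)) p.1 q.1

/-- Completely positive trace-preserving maps: `Φ ⊗ id_k` preserves positivity for every
dimension `k` of the ancilla, and `Φ` preserves the trace. -/
structure IsCPTP {α : Type*} [Fintype α] (Φ : Matrix α α ℂ →ₗ[ℂ] Matrix α α ℂ) : Prop where
  completelyPositive : ∀ (k : ℕ) (X : Matrix (α × Fin k) (α × Fin k) ℂ),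
    X.PosSemidef → (applyLocal Φ X).PosSemidef
  tracePreserving : ∀ X : Matrix α α ℂ, (Φ X).trace = X.trace

/-- The energy `Tr (H ρ)` (a real number for Hermitian `H` and `ρ`). -/
noncomputable def energy {ι : Type*} [Fintype ι] (H ρ : Matrix ι ι ℂ) : ℝ :=
  (H * ρ).trace.re

/-- The set of energies `Tr (H ρ) - Tr (H (Φ ⊗ id_B) ρ)` that can be extracted from `ρ` by CPTP
maps `Φ` acting on the subsystem `A` alone. -/
def extractableEnergies {α β : Type*} [Fintype α] [Fintype β]
    (ρ H : Matrix (α × β) (α × β) ℂ) : Set ℝ :=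
  {w | ∃ Φ : Matrix α α ℂ →ₗ[ℂ] Matrix α α ℂ,
    IsCPTP Φ ∧ w = energy H ρ - energy H (applyLocal Φ ρ)}

/-- `ρ` is a state of `AB`, `H` is a Hamiltonian of `AB`, and the maximum energy extractable by
CPTP maps on `A` is zero. -/
structure IsCPTPLocalPassive {α β : Type*} [Fintype α] [Fintype β]
    (ρ H : Matrix (α × β) (α × β) ℂ) : Prop where
  isState : IsState ρ
  isHermitian : H.IsHermitian
  isGreatest : IsGreatest (extractableEnergies ρ H) 0

/-- The tensor product `X₀ ⊗ X₁ ⊗ ⋯ ⊗ Xₙ₋₁` of operators on `n` copies of `AB`, as an operator on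
the bipartite system whose first part is `A₀A₁⋯Aₙ₋₁` and whose second part is `B₀B₁⋯Bₙ₋₁`. -/
def tensorCopies {α β : Type*} {n : ℕ} (X : Fin n → Matrix (α × β) (α × β) ℂ) :
    Matrix ((Fin n → α) × (Fin n → β)) ((Fin n → α) × (Fin n → β)) ℂ :=
  Matrix.of fun p q => ∏ i, X i (p.1 i, p.2 i) (q.1 i, q.2 i)

/-- `ρ^{⊗ n}`. -/
def tensorPow {α β : Type*} (ρ : Matrix (α × β) (α × β) ℂ) (n : ℕ) :
    Matrix ((Fin n → α) × (Fin n → β)) ((Fin n → α) × (Fin n → β)) ℂ :=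
  tensorCopies fun _ : Fin n => ρ

/-- The non-interacting Hamiltonian `H ⊗ I ⊗ ⋯ ⊗ I + I ⊗ H ⊗ ⋯ ⊗ I + ⋯ + I ⊗ I ⊗ ⋯ ⊗ H` of `n`
copies of `AB`. -/
def sumHamiltonian {α β : Type*} [DecidableEq α] [DecidableEq β]
    (H : Matrix (α × β) (α × β) ℂ) (n : ℕ) :
    Matrix ((Fin n → α) × (Fin n → β)) ((Fin n → α) × (Fin n → β)) ℂ :=
  ∑ i : Fin n, tensorCopies (Function.update (fun _ => 1) i H)

/-! The energy after a channel on `A` is linear in its Choi matrix `J`, namely `Tr (C J)` with `C =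
localCost H ρ`, so passivity says that the identity channel solves a semidefinite program: minimize
`Tr (C J)` over `J ≥ 0` whose partial trace over the output is `1`. A dual certificate is a matrix
`Z` with `C - 1 ⊗ Z ≥ 0` and `Re Tr Z` equal to the initial energy. Weak duality makes it sufficient
(`isCPTPLocalPassive_of_certificate`). It is also necessary
(`IsCPTPLocalPassive.exists_certificate`): the first-order optimality condition at the identity
channel yields `Z` explicitly.

Certificates pass to `n` copies. With `W` the transposed reduced state on `A`, the cost of the
identity Hamiltonian is `1 ⊗ W`, so the `n`-copy cost is the sum over `k` of tensor products with
`C` in slot `k` and `1 ⊗ W` elsewhere. Putting `Z` in slot `k` and `W` elsewhere, and summing over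
`k`, gives a certificate: the difference is a sum of tensor products of positive factors, and the
traces add up because `Tr W = 1`. Nothing restricts the joint channel to be a product. -/

open Matrix
open scoped Kronecker

/-! ### Choi matrices and weak duality -/

section Certificate

variable {α β : Type*} [Fintype α] [Fintype β]

/-- The Choi matrix of a linear map on operators. -/
def choiMatrix [DecidableEq α] (Φ : Matrix α α ℂ →ₗ[ℂ] Matrix α α ℂ) :
    Matrix (α × α) (α × α) ℂ :=
  Matrix.of fun x y => Φ (Matrix.single x.2 y.2 1) x.1 y.1

/-- The operator whose trace against the Choi matrix of `Φ` is the energy of `(Φ ⊗ id) ρ`. -/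
def localCost (H ρ : Matrix (α × β) (α × β) ℂ) : Matrix (α × α) (α × α) ℂ :=
  Matrix.of fun x y => ∑ r : β × β, H (x.1, r.1) (y.1, r.2) * ρ (y.2, r.2) (x.2, r.1)

theorem map_apply_eq_sum_choiMatrix [DecidableEq α] (Φ : Matrix α α ℂ →ₗ[ℂ] Matrix α α ℂ)
    (M : Matrix α α ℂ) (p q : α) :
    Φ M p q = ∑ r : α × α, M r.1 r.2 * choiMatrix Φ (p, r.1) (q, r.2) := by
  conv_lhs => rw [matrix_eq_sum_single M]
  simp only [map_sum, Matrix.sum_apply, Fintype.sum_prod_type, choiMatrix, Matrix.of_apply]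
  refine Finset.sum_congr rfl fun i _ => Finset.sum_congr rfl fun j _ => ?_
  have : Matrix.single i j (M i j) = M i j • Matrix.single i j (1 : ℂ) := by simp
  rw [this, map_smul, Matrix.smul_apply, smul_eq_mul]

theorem trace_mul_applyLocal [DecidableEq α] (H ρ : Matrix (α × β) (α × β) ℂ)
    (Φ : Matrix α α ℂ →ₗ[ℂ] Matrix α α ℂ) :
    (H * applyLocal Φ ρ).trace = (localCost H ρ * choiMatrix Φ).trace := by
  simp only [Matrix.trace, Matrix.diag_apply, Matrix.mul_apply, applyLocal, localCost,
    Matrix.of_apply, map_apply_eq_sum_choiMatrix, Finset.mul_sum, Finset.sum_mul]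
  simp only [← Finset.univ_product_univ, ← Finset.sum_product']
  simp only [Finset.univ_product_univ]
  let e : (α × β) × ((α × β) × (α × α)) ≃ (α × α) × ((α × α) × (β × β)) :=
    { toFun := fun t => ((t.1.1, t.2.2.2), ((t.2.1.1, t.2.2.1), (t.1.2, t.2.1.2)))
      invFun := fun t => ((t.1.1, t.2.2.1), ((t.2.1.1, t.2.2.2), (t.2.1.2, t.1.2)))
      left_inv := fun _ => rfl
      right_inv := fun _ => rfl }
  exact Fintype.sum_equiv e _ _ fun t => (mul_assoc _ _ _).symm

omit [Fintype α] in
theorem isHermitian_localCost {H ρ : Matrix (α × β) (α × β) ℂ} (hH : H.IsHermitian)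
    (hρ : ρ.IsHermitian) : (localCost H ρ).IsHermitian := by
  ext x y
  simp only [localCost, Matrix.conjTranspose_apply, Matrix.of_apply, star_sum, star_mul',
    hH.apply, hρ.apply]
  exact Fintype.sum_equiv (Equiv.prodComm β β) _ _ fun _ => rfl

/-- Complete positivity is postulated for ancillas `Fin k` only; enumerating `β` transports it to
any finite system. -/
theorem applyLocal_posSemidef [DecidableEq α] {Φ : Matrix α α ℂ →ₗ[ℂ] Matrix α α ℂ}
    (hΦ : IsCPTP Φ) {X : Matrix (α × β) (α × β) ℂ} (hX : X.PosSemidef) :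
    (applyLocal Φ X).PosSemidef := by
  let e := Fintype.equivFin β
  have h := hΦ.completelyPositive (Fintype.card β)
    (X.submatrix (Prod.map id e.symm) (Prod.map id e.symm)) (hX.submatrix _)
  convert h.submatrix (Prod.map id e) using 1
  ext p q
  simp [applyLocal]

-- The input is the unnormalized maximally entangled projector, so complete positivity makes the
-- Choi matrix positive.
omit [Fintype α] in
theorem choiMatrix_eq_applyLocal [DecidableEq α] (Φ : Matrix α α ℂ →ₗ[ℂ] Matrix α α ℂ) :
    choiMatrix Φ = applyLocal Φ (vecMulVec (Function.uncurry (1 : Matrix α α ℂ))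
      (star (Function.uncurry (1 : Matrix α α ℂ)))) := by
  ext x y
  simp only [choiMatrix, applyLocal, Matrix.of_apply]
  refine congrFun (congrFun (congrArg Φ ?_) _) _
  ext i j
  by_cases h1 : i = x.2 <;> by_cases h2 : j = y.2 <;>
    simp [vecMulVec_apply, Matrix.one_apply, Function.uncurry, h1, h2,
      eq_comm]

theorem choiMatrix_posSemidef [DecidableEq α] {Φ : Matrix α α ℂ →ₗ[ℂ] Matrix α α ℂ}
    (hΦ : IsCPTP Φ) : (choiMatrix Φ).PosSemidef := by
  rw [choiMatrix_eq_applyLocal]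
  exact applyLocal_posSemidef hΦ (posSemidef_vecMulVec_self_star _)

/-- Trace preservation says that tracing the output out of the Choi matrix leaves the identity.
Hence the dual value does not depend on the channel. -/
theorem trace_one_kronecker_mul_choiMatrix [DecidableEq α]
    {Φ : Matrix α α ℂ →ₗ[ℂ] Matrix α α ℂ} (hΦ : IsCPTP Φ) (Z : Matrix α α ℂ) :
    (((1 : Matrix α α ℂ) ⊗ₖ Z) * choiMatrix Φ).trace = Z.trace := by
  have htp (i j : α) : ∑ p, choiMatrix Φ (p, i) (p, j) = if i = j then 1 else 0 := by
    have := hΦ.tracePreserving (Matrix.single i j 1)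
    rw [Matrix.trace] at this
    simp only [choiMatrix, Matrix.of_apply]
    refine this.trans ?_
    split_ifs with h
    · subst h; simp
    · exact Matrix.trace_single_eq_of_ne _ _ _ h
  have h1 : (((1 : Matrix α α ℂ) ⊗ₖ Z) * choiMatrix Φ).trace
      = ∑ p, ∑ j, ∑ i, Z j i * choiMatrix Φ (p, i) (p, j) := by
    simp [Matrix.trace, Matrix.mul_apply, Fintype.sum_prod_type, Matrix.one_apply]
  rw [h1, Finset.sum_comm]
  simp_rw [Finset.sum_comm (s := Finset.univ (α := α)) (f := fun p i => Z _ i * _),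
    ← Finset.mul_sum, htp]
  simp [Matrix.trace]

/-- Factor `B = Cᴴ * C` and cycle: the trace is that of the positive matrix `C * A * Cᴴ`. -/
theorem re_trace_mul_nonneg {ι : Type*} [Fintype ι] {A B : Matrix ι ι ℂ} (hA : A.PosSemidef)
    (hB : B.PosSemidef) : 0 ≤ (A * B).trace.re := by
  classical
  obtain ⟨C, rfl⟩ : ∃ C : Matrix ι ι ℂ, B = Cᴴ * C := by
    open scoped MatrixOrder in
    exact CStarAlgebra.nonneg_iff_eq_star_mul_self.mp hB.nonneg
  rw [← Matrix.mul_assoc, Matrix.trace_mul_comm, ← Matrix.mul_assoc]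
  exact (Complex.nonneg_iff.mp (hA.mul_mul_conjTranspose_same C).trace_nonneg).1

omit [Fintype α] [Fintype β] in
theorem applyLocal_id (ρ : Matrix (α × β) (α × β) ℂ) : applyLocal LinearMap.id ρ = ρ := rfl

theorem isCPTP_id : IsCPTP (LinearMap.id : Matrix α α ℂ →ₗ[ℂ] Matrix α α ℂ) where
  completelyPositive _ _ hX := hX
  tracePreserving _ := rfl

/-- A dual certificate for the optimality of the identity channel. -/
theorem isCPTPLocalPassive_of_certificate [DecidableEq α] {ρ H : Matrix (α × β) (α × β) ℂ}
    (hρ : IsState ρ) (hH : H.IsHermitian) (Z : Matrix α α ℂ)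
    (hZ : (localCost H ρ - (1 : Matrix α α ℂ) ⊗ₖ Z).PosSemidef)
    (htr : Z.trace.re = energy H ρ) : IsCPTPLocalPassive ρ H where
  isState := hρ
  isHermitian := hH
  isGreatest := by
    refine ⟨⟨LinearMap.id, isCPTP_id, by rw [applyLocal_id, sub_self]⟩, ?_⟩
    rintro _ ⟨Φ, hΦ, rfl⟩
    have h := re_trace_mul_nonneg hZ (choiMatrix_posSemidef hΦ)
    rw [Matrix.sub_mul, Matrix.trace_sub, trace_one_kronecker_mul_choiMatrix hΦ,
      ← trace_mul_applyLocal, Complex.sub_re, htr] at h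
    simpa [energy] using h

end Certificate

/-! ### Kraus maps and the energy as a quadratic form in the Kraus operators -/

section Kraus

variable {α β : Type*} [Fintype α] [Fintype β]

/-- The map `X ↦ ∑ k, K k X (K k)ᴴ`. -/
def krausMap {κ : Type*} [Fintype κ] (K : κ → Matrix α α ℂ) :
    Matrix α α ℂ →ₗ[ℂ] Matrix α α ℂ :=
  ∑ k, (LinearMap.mulRight ℂ (K k)ᴴ).comp (LinearMap.mulLeft ℂ (K k))

theorem krausMap_apply {κ : Type*} [Fintype κ] (K : κ → Matrix α α ℂ) (X : Matrix α α ℂ) :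
    krausMap K X = ∑ k, K k * X * (K k)ᴴ := by
  simp [krausMap]

theorem applyLocal_krausMap {κ : Type*} [Fintype κ] [DecidableEq β] (K : κ → Matrix α α ℂ)
    (X : Matrix (α × β) (α × β) ℂ) :
    applyLocal (krausMap K) X =
      ∑ k, (K k ⊗ₖ (1 : Matrix β β ℂ)) * X * (K k ⊗ₖ (1 : Matrix β β ℂ))ᴴ := by
  ext p q
  simp [applyLocal, krausMap_apply, Matrix.sum_apply, Matrix.mul_apply, Fintype.sum_prod_type,
    Matrix.one_apply, Finset.sum_mul, apply_ite]

theorem isCPTP_krausMap [DecidableEq α] {κ : Type*} [Fintype κ] {K : κ → Matrix α α ℂ}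
    (hK : ∑ k, (K k)ᴴ * K k = 1) : IsCPTP (krausMap K) where
  completelyPositive n X hX := by
    rw [applyLocal_krausMap]
    exact posSemidef_sum _ fun k _ => hX.mul_mul_conjTranspose_same _
  tracePreserving X := by
    rw [krausMap_apply, Matrix.trace_sum]
    simp_rw [Matrix.trace_mul_comm _ (K _)ᴴ, ← Matrix.mul_assoc]
    rw [← Matrix.trace_sum, ← Matrix.sum_mul, hK, Matrix.one_mul]

theorem choiMatrix_krausMap [DecidableEq α] {κ : Type*} [Fintype κ] (K : κ → Matrix α α ℂ) :
    choiMatrix (krausMap K) =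
      ∑ k, vecMulVec (Function.uncurry (K k)) (star (Function.uncurry (K k))) := by
  ext x y
  simp [choiMatrix, krausMap_apply, Matrix.sum_apply, vecMulVec_apply, Function.uncurry,
    Matrix.mul_single_eq_updateCol_zero, Matrix.mul_apply, Matrix.updateCol_apply]

/-- The energy of `(K ⊗ 1) ρ (K ⊗ 1)ᴴ`. -/
noncomputable def krausEnergy (H ρ : Matrix (α × β) (α × β) ℂ) (K : Matrix α α ℂ) : ℝ :=
  (star (Function.uncurry K) ⬝ᵥ (localCost H ρ *ᵥ Function.uncurry K)).re

theorem energy_applyLocal_krausMap {κ : Type*} [Fintype κ]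
    (H ρ : Matrix (α × β) (α × β) ℂ) (K : κ → Matrix α α ℂ) :
    energy H (applyLocal (krausMap K) ρ) = ∑ k, krausEnergy H ρ (K k) := by
  classical
  rw [energy, trace_mul_applyLocal, choiMatrix_krausMap, Matrix.mul_sum, Matrix.trace_sum,
    Complex.re_sum]
  refine Finset.sum_congr rfl fun k _ => ?_
  rw [krausEnergy, mul_vecMulVec, trace_vecMulVec, dotProduct_comm]

theorem krausEnergy_smul (H ρ : Matrix (α × β) (α × β) ℂ) (K : Matrix α α ℂ) (s : ℝ) :
    krausEnergy H ρ ((s : ℂ) • K) = s ^ 2 * krausEnergy H ρ K := by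
  have : Function.uncurry ((s : ℂ) • K) = (s : ℂ) • Function.uncurry K := rfl
  rw [krausEnergy, krausEnergy, this, mulVec_smul, dotProduct_smul, star_smul, smul_dotProduct]
  simp only [RCLike.star_def, Complex.conj_ofReal, smul_eq_mul, ← mul_assoc,
    ← Complex.ofReal_mul, Complex.re_ofReal_mul]
  ring

/-- The polarization of `krausEnergy` at the identity. -/
noncomputable def krausEnergyDeriv [DecidableEq α] (H ρ : Matrix (α × β) (α × β) ℂ)
    (X : Matrix α α ℂ) : ℝ :=
  (star (Function.uncurry (1 : Matrix α α ℂ)) ⬝ᵥ (localCost H ρ *ᵥ Function.uncurry X)).re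

/-- The two cross terms have equal real parts because `localCost H ρ` is Hermitian. -/
theorem krausEnergy_one_add_smul [DecidableEq α] {H ρ : Matrix (α × β) (α × β) ℂ}
    (hH : H.IsHermitian) (hρ : ρ.IsHermitian) (X : Matrix α α ℂ) (s : ℝ) :
    krausEnergy H ρ (1 + (s : ℂ) • X) =
      krausEnergy H ρ 1 + 2 * s * krausEnergyDeriv H ρ X + s ^ 2 * krausEnergy H ρ X := by
  have hu : Function.uncurry ((1 : Matrix α α ℂ) + (s : ℂ) • X) =
    Function.uncurry (1 : Matrix α α ℂ) + (s : ℂ) • Function.uncurry X := rfl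
  have hsymm : (star (Function.uncurry X) ⬝ᵥ
      (localCost H ρ *ᵥ Function.uncurry (1 : Matrix α α ℂ))).re = krausEnergyDeriv H ρ X := by
    have := star_dotProduct (Function.uncurry X)
      (localCost H ρ *ᵥ Function.uncurry (1 : Matrix α α ℂ))
    rw [this, star_mulVec, (isHermitian_localCost hH hρ).eq, ← dotProduct_mulVec]
    simp [krausEnergyDeriv]
  rw [krausEnergy, hu, star_add, mulVec_add, add_dotProduct, dotProduct_add, dotProduct_add,
    mulVec_smul, star_smul]
  simp only [dotProduct_smul, smul_dotProduct, RCLike.star_def, Complex.conj_ofReal, smul_eq_mul,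
    Complex.add_re, Complex.re_ofReal_mul, hsymm]
  simp only [krausEnergy, krausEnergyDeriv]
  ring

end Kraus

/-! ### First-order optimality and strong duality -/

section Necessity

variable {α β : Type*} [Fintype α] [Fintype β]

theorem energy_eq_krausEnergy_one [DecidableEq α] (H ρ : Matrix (α × β) (α × β) ℂ) :
    energy H ρ = krausEnergy H ρ 1 := by
  have h := energy_applyLocal_krausMap H ρ fun _ : Unit => (1 : Matrix α α ℂ)
  have hid : krausMap (fun _ : Unit => (1 : Matrix α α ℂ)) = LinearMap.id := by
    ext X : 1
    simp [krausMap_apply]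
  rw [hid, applyLocal_id] at h
  simpa using h

theorem IsCPTPLocalPassive.energy_le [DecidableEq α] {ρ H : Matrix (α × β) (α × β) ℂ}
    (h : IsCPTPLocalPassive ρ H) {κ : Type*} [Fintype κ] {K : κ → Matrix α α ℂ}
    (hK : ∑ k, (K k)ᴴ * K k = 1) : krausEnergy H ρ 1 ≤ ∑ k, krausEnergy H ρ (K k) := by
  have := h.isGreatest.2 ⟨krausMap K, isCPTP_krausMap hK, rfl⟩
  rw [energy_applyLocal_krausMap, energy_eq_krausEnergy_one] at this
  linarith

/-- Dividing the Kraus operators by `√t` restores normalization and scales the quadratic energy by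
`t⁻¹`; perturbed families thus need normalization only up to a scalar. -/
theorem IsCPTPLocalPassive.smul_energy_le [DecidableEq α] {ρ H : Matrix (α × β) (α × β) ℂ}
    (h : IsCPTPLocalPassive ρ H) {κ : Type*} [Fintype κ] {K : κ → Matrix α α ℂ} {t : ℝ}
    (ht : 0 < t) (hK : ∑ k, (K k)ᴴ * K k = (t : ℂ) • 1) :
    t * krausEnergy H ρ 1 ≤ ∑ k, krausEnergy H ρ (K k) := by
  have hs : (√t)⁻¹ ^ 2 = t⁻¹ := by rw [inv_pow, Real.sq_sqrt ht.le]
  have h1 := h.energy_le (K := fun k => (((√t)⁻¹ : ℝ) : ℂ) • K k) (by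
    simp only [conjTranspose_smul, Matrix.smul_mul, Matrix.mul_smul, smul_smul, RCLike.star_def,
      Complex.conj_ofReal, ← Finset.smul_sum, hK, ← Complex.ofReal_mul]
    rw [← sq, hs, inv_mul_cancel₀ ht.ne', Complex.ofReal_one, one_smul])
  simp only [krausEnergy_smul, hs, ← Finset.mul_sum] at h1
  rwa [← div_eq_inv_mul, le_div_iff₀ ht, mul_comm] at h1

-- Since `Xᴴ * X` is bounded by its norm `c`, the remainder `c • 1 - Xᴴ * X` is positive and factors
-- as `Sᴴ * S`.
open scoped MatrixOrder Matrix.Norms.L2Operator in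
theorem exists_add_conjTranspose_mul_self_eq_smul_one [DecidableEq α] (X : Matrix α α ℂ) :
    ∃ (c : ℝ) (S : Matrix α α ℂ), 0 ≤ c ∧ Xᴴ * X + Sᴴ * S = (c : ℂ) • 1 := by
  have h : Xᴴ * X ≤ algebraMap ℝ (Matrix α α ℂ) ‖Xᴴ * X‖ :=
    IsSelfAdjoint.le_algebraMap_norm_self (ha := isHermitian_conjTranspose_mul_self X)
  obtain ⟨S, hS⟩ := CStarAlgebra.nonneg_iff_eq_star_mul_self.mp (sub_nonneg.mpr h)
  refine ⟨‖Xᴴ * X‖, S, norm_nonneg _, ?_⟩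
  rw [← star_eq_conjTranspose S, ← hS, add_sub_cancel, Algebra.algebraMap_eq_smul_one]
  rfl

/-- This is the first-order condition at the identity along an infinitesimal channel with jump
operator `L`, whose no-jump operator is `1 - s² Lᴴ L / 2` to leading order. -/
theorem IsCPTPLocalPassive.le_krausEnergy [DecidableEq α] {ρ H : Matrix (α × β) (α × β) ℂ}
    (h : IsCPTPLocalPassive ρ H) (L : Matrix α α ℂ) :
    krausEnergyDeriv H ρ (Lᴴ * L) ≤ krausEnergy H ρ L := by
  set X : Matrix α α ℂ := ((-(1 / 2) : ℝ) : ℂ) • (Lᴴ * L) with hX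
  have hXself : Xᴴ = X := by
    rw [hX, conjTranspose_smul, RCLike.star_def, Complex.conj_ofReal,
      (isHermitian_conjTranspose_mul_self L).eq]
  have hXL : X + X + Lᴴ * L = 0 := by
    rw [hX, ← add_smul, ← Complex.ofReal_add]
    norm_num
  have hB : krausEnergyDeriv H ρ X = -(1 / 2) * krausEnergyDeriv H ρ (Lᴴ * L) := by
    have hu : Function.uncurry X = ((-(1 / 2) : ℝ) : ℂ) • Function.uncurry (Lᴴ * L) := rfl
    rw [krausEnergyDeriv, krausEnergyDeriv, hu, mulVec_smul, dotProduct_smul, smul_eq_mul,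
      Complex.re_ofReal_mul]
  obtain ⟨c, S, hc, hS⟩ := exists_add_conjTranspose_mul_self_eq_smul_one X
  have key (s : ℝ) : (1 + s ^ 4 * c) * krausEnergy H ρ 1 ≤
      krausEnergy H ρ 1 + 2 * s ^ 2 * krausEnergyDeriv H ρ X + s ^ 4 * krausEnergy H ρ X
        + s ^ 2 * krausEnergy H ρ L + s ^ 4 * krausEnergy H ρ S := by
    have hpos : 0 < 1 + s ^ 4 * c := by positivity
    have := h.smul_energy_le (t := 1 + s ^ 4 * c)
      -- The choice of `X` cancels the `s²` terms of the normalization, and `S` completes the `s⁴`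
      -- terms to a multiple of the identity, giving exactly `1 + s⁴ c`.
      (K := ![1 + ((s ^ 2 : ℝ) : ℂ) • X, (s : ℂ) • L, ((s ^ 2 : ℝ) : ℂ) • S]) hpos (by
        have e : (1 + s ^ 4 * c : ℝ) • (1 : Matrix α α ℂ) =
            1 + (s ^ 2 : ℝ) • (X + X + Lᴴ * L) + (s ^ 4 : ℝ) • (Xᴴ * X + Sᴴ * S) := by
          rw [hXL, hS, smul_zero, add_zero, add_smul, one_smul, mul_smul]
          rfl
        simp only [Fin.sum_univ_three, Matrix.cons_val_zero, Matrix.cons_val_one,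
          Matrix.cons_val]
        simp only [Complex.coe_smul, conjTranspose_add, conjTranspose_one, conjTranspose_smul,
          star_trivial, hXself] at e ⊢
        rw [e]
        simp only [add_mul, mul_add, one_mul, mul_one, smul_mul_smul_comm]
        match_scalars <;> ring)
    simp only [Fin.sum_univ_three, Matrix.cons_val_zero, Matrix.cons_val_one, Matrix.cons_val,
      krausEnergy_smul] at this
    rw [krausEnergy_one_add_smul h.isHermitian h.isState.posSemidef.isHermitian] at this
    linarith
  by_contra! hlt
  set a := krausEnergyDeriv H ρ (Lᴴ * L) - krausEnergy H ρ L with ha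
  set b := krausEnergy H ρ X + krausEnergy H ρ S - c * krausEnergy H ρ 1 with hb
  have hapos : 0 < a := sub_pos.mpr hlt
  have key2 (s : ℝ) (hs : 0 < s) : a ≤ s ^ 2 * b := by
    have hk := key s
    rw [hB] at hk
    have : s ^ 2 * a ≤ s ^ 2 * (s ^ 2 * b) := by rw [ha, hb]; linarith
    exact le_of_mul_le_mul_left this (by positivity)
  have hbpos : 0 < b := by have := key2 1 one_pos; linarith
  -- This `s` makes `s² b = a / 2`, contradicting `0 < a ≤ s² b`.
  have := key2 √(a / (2 * b)) (by positivity)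
  rw [Real.sq_sqrt (by positivity)] at this
  have e : a / (2 * b) * b = a / 2 := by field_simp
  linarith

/-- Strong duality at the identity channel: a passive pair has a dual certificate. -/
theorem IsCPTPLocalPassive.exists_certificate [DecidableEq α] {ρ H : Matrix (α × β) (α × β) ℂ}
    (h : IsCPTPLocalPassive ρ H) :
    ∃ Z : Matrix α α ℂ, (localCost H ρ - (1 : Matrix α α ℂ) ⊗ₖ Z).PosSemidef ∧
      Z.trace.re = energy H ρ := by
  -- The gradient at the identity: the functional `⟨1| C` on vectorized operators, reshaped into a
  -- matrix.
  let Y : Matrix α α ℂ := Matrix.of fun x y => ∑ j, localCost H ρ (j, j) (x, y)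
  have hC := isHermitian_localCost h.isHermitian h.isState.posSemidef.isHermitian
  have hderiv (X : Matrix α α ℂ) : krausEnergyDeriv H ρ X = (∑ x, ∑ y, Y x y * X x y).re := by
    rw [krausEnergyDeriv, dotProduct_mulVec]
    congr 1
    simp [dotProduct, Fintype.sum_prod_type, vecMul, Y, Function.uncurry, Matrix.one_apply,
      apply_ite]
  have hquad (L : Matrix α α ℂ) (W : Matrix α α ℂ) :
      star (Function.uncurry L) ⬝ᵥ (((1 : Matrix α α ℂ) ⊗ₖ W) *ᵥ Function.uncurry L) =
        ∑ x, ∑ y, W x y * (Lᴴ * L) x y := by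
    simp only [dotProduct, Fintype.sum_prod_type, mulVec, Function.uncurry, kroneckerMap_apply,
      Matrix.one_apply, Matrix.mul_apply, conjTranspose_apply, Finset.mul_sum, Pi.star_apply,
      ite_mul, one_mul, zero_mul, Finset.sum_ite_irrel, Finset.sum_const_zero,
      Finset.sum_ite_eq, Finset.mem_univ, if_true]
    rw [Finset.sum_comm]
    refine Finset.sum_congr rfl fun x _ => ?_
    rw [Finset.sum_comm]
    exact Finset.sum_congr rfl fun y _ => Finset.sum_congr rfl fun p _ => by ring
  -- `Y` need not be Hermitian a priori, but only its real pairing with Hermitian matrices such as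
  -- `Lᴴ * L` matters, and its Hermitian part has the same one.
  let Z : Matrix α α ℂ := ((1 / 2 : ℝ) : ℂ) • (Y + Yᴴ)
  have hZ : Z.IsHermitian := by
    simp only [Z, Matrix.IsHermitian, conjTranspose_smul, conjTranspose_add,
      conjTranspose_conjTranspose, RCLike.star_def, Complex.conj_ofReal, add_comm]
  have hZre (G : Matrix α α ℂ) (hG : G.IsHermitian) :
      (∑ x, ∑ y, Z x y * G x y).re = (∑ x, ∑ y, Y x y * G x y).re := by
    have e : ∑ x, ∑ y, Yᴴ x y * G x y = star (∑ x, ∑ y, Y x y * G x y) := by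
      rw [Finset.sum_comm]
      simp only [star_sum, star_mul', hG.apply, conjTranspose_apply]
    have e2 : ∑ x, ∑ y, Z x y * G x y =
        ((1 / 2 : ℝ) : ℂ) * (∑ x, ∑ y, Y x y * G x y + ∑ x, ∑ y, Yᴴ x y * G x y) := by
      simp only [Z, Matrix.smul_apply, Matrix.add_apply, smul_eq_mul, ← Finset.sum_add_distrib,
        Finset.mul_sum]
      exact Finset.sum_congr rfl fun x _ => Finset.sum_congr rfl fun y _ => by ring
    rw [e2, e, Complex.re_ofReal_mul, Complex.add_re, RCLike.star_def, Complex.conj_re]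
    ring
  refine ⟨Z, ?_, ?_⟩
  · have hherm : (localCost H ρ - (1 : Matrix α α ℂ) ⊗ₖ Z).IsHermitian := by
      refine hC.sub ?_
      rw [Matrix.IsHermitian, conjTranspose_kronecker, conjTranspose_one, hZ.eq]
    refine .of_dotProduct_mulVec_nonneg hherm fun v => ?_
    rw [Complex.nonneg_iff]
    refine ⟨?_, (hherm.im_star_dotProduct_mulVec_self v).symm⟩
    -- Every vector is a vectorized operator `L`, so the first-order conditions for all `L` are
    -- together the positivity of `C - 1 ⊗ Z`.
    let L : Matrix α α ℂ := Matrix.of (Function.curry v)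
    have hv : Function.uncurry L = v := rfl
    have hle := h.le_krausEnergy L
    rw [hderiv, ← hZre _ (isHermitian_conjTranspose_mul_self _), ← hquad, krausEnergy, hv] at hle
    rw [sub_mulVec, dotProduct_sub, Complex.sub_re]
    exact sub_nonneg.mpr hle
  -- At `L = 1` the first-order condition is an equality, which gives the trace of `Z`.
  · have h1 : krausEnergyDeriv H ρ 1 = krausEnergy H ρ 1 := rfl
    rw [energy_eq_krausEnergy_one, ← h1, hderiv, ← hZre _ isHermitian_one]
    simp [Matrix.trace, Matrix.one_apply]

end Necessity

/-! ### Tensor products, and the cost matrix of several copies -/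

section TensorCopies

variable {α β : Type*} {n : ℕ}

theorem sum_prod_arrow_prod [Fintype α] [Fintype β] (g : Fin n → α × β → ℂ) :
    ∑ p : (Fin n → α) × (Fin n → β), ∏ l, g l (p.1 l, p.2 l) = ∏ l, ∑ x, g l x := by
  rw [Fintype.prod_sum]
  exact Fintype.sum_equiv (Equiv.arrowProdEquivProdArrow (Fin n) (fun _ => α) fun _ => β).symm _ _
    fun _ => rfl

theorem tensorCopies_mul [Fintype α] [Fintype β] (X Y : Fin n → Matrix (α × β) (α × β) ℂ) :
    tensorCopies X * tensorCopies Y = tensorCopies fun l => X l * Y l := by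
  ext p q
  simp only [tensorCopies, Matrix.mul_apply, Matrix.of_apply, ← Finset.prod_mul_distrib]
  exact sum_prod_arrow_prod fun l x => X l (p.1 l, p.2 l) x * Y l x (q.1 l, q.2 l)

theorem trace_tensorCopies [Fintype α] [Fintype β] (X : Fin n → Matrix (α × β) (α × β) ℂ) :
    (tensorCopies X).trace = ∏ l, (X l).trace :=
  sum_prod_arrow_prod fun l x => X l x x

theorem conjTranspose_tensorCopies (X : Fin n → Matrix (α × β) (α × β) ℂ) :
    (tensorCopies X)ᴴ = tensorCopies fun l => (X l)ᴴ := by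
  ext p q
  simp [tensorCopies]

/-- Factorizations `Cᴴ * C` of the factors multiply to one of the tensor product. -/
theorem tensorCopies_posSemidef [Fintype α] [Fintype β] {X : Fin n → Matrix (α × β) (α × β) ℂ}
    (hX : ∀ l, (X l).PosSemidef) : (tensorCopies X).PosSemidef := by
  classical
  have (l : Fin n) : ∃ C : Matrix (α × β) (α × β) ℂ, X l = Cᴴ * C := by
    open scoped MatrixOrder in
    exact CStarAlgebra.nonneg_iff_eq_star_mul_self.mp (hX l).nonneg
  choose C hC using this
  have : tensorCopies X = (tensorCopies C)ᴴ * tensorCopies C := by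
    rw [conjTranspose_tensorCopies, tensorCopies_mul]
    exact congrArg _ (funext hC)
  rw [this]
  exact posSemidef_conjTranspose_mul_self _

theorem tensorCopies_update_sub (X : Fin n → Matrix (α × β) (α × β) ℂ) (k : Fin n)
    (S T : Matrix (α × β) (α × β) ℂ) :
    tensorCopies (Function.update X k (S - T)) =
      tensorCopies (Function.update X k S) - tensorCopies (Function.update X k T) := by
  ext p q
  have h (W : Matrix (α × β) (α × β) ℂ) : tensorCopies (Function.update X k W) p q =
      W (p.1 k, p.2 k) (q.1 k, q.2 k) *
        ∏ l ∈ Finset.univ.erase k, X l (p.1 l, p.2 l) (q.1 l, q.2 l) := by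
    rw [tensorCopies, Matrix.of_apply, ← Finset.mul_prod_erase _ _ (Finset.mem_univ k),
      Function.update_self]
    congr 1
    exact Finset.prod_congr rfl fun l hl => by
      rw [Function.update_of_ne (Finset.ne_of_mem_erase hl)]
  rw [Matrix.sub_apply, h, h, h, Matrix.sub_apply, sub_mul]

theorem tensorPow_isState [Fintype α] [Fintype β] {ρ : Matrix (α × β) (α × β) ℂ}
    (hρ : IsState ρ) (n : ℕ) : IsState (tensorPow ρ n) where
  posSemidef := tensorCopies_posSemidef fun _ => hρ.posSemidef
  trace_eq_one := by rw [tensorPow, trace_tensorCopies]; simp [hρ.trace_eq_one]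

theorem sumHamiltonian_isHermitian [DecidableEq α] [DecidableEq β]
    {H : Matrix (α × β) (α × β) ℂ} (hH : H.IsHermitian) (n : ℕ) :
    (sumHamiltonian H n).IsHermitian := by
  rw [Matrix.IsHermitian, sumHamiltonian, conjTranspose_sum]
  refine Finset.sum_congr rfl fun k _ => ?_
  rw [conjTranspose_tensorCopies]
  congr 1
  ext1 l
  obtain rfl | hl := eq_or_ne l k
  · simp [hH.eq]
  · simp [hl]

theorem energy_sumHamiltonian_tensorPow [Fintype α] [DecidableEq α] [Fintype β] [DecidableEq β]
    {ρ : Matrix (α × β) (α × β) ℂ} (hρ : IsState ρ) (H : Matrix (α × β) (α × β) ℂ) (n : ℕ) :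
    energy (sumHamiltonian H n) (tensorPow ρ n) = n * energy H ρ := by
  have h (k : Fin n) : (tensorCopies (Function.update (fun _ => 1) k H) * tensorPow ρ n).trace =
      (H * ρ).trace := by
    rw [tensorPow, tensorCopies_mul, trace_tensorCopies, Fintype.prod_eq_single k]
    · simp
    · intro l hl
      simp [hl, hρ.trace_eq_one]
  simp [energy, sumHamiltonian, Matrix.sum_mul, h]

theorem localCost_tensorCopies [Fintype β] (X R : Fin n → Matrix (α × β) (α × β) ℂ) :
    localCost (tensorCopies X) (tensorCopies R) = tensorCopies fun l => localCost (X l) (R l) := by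
  ext x y
  simp only [localCost, tensorCopies, Matrix.of_apply, ← Finset.prod_mul_distrib]
  exact sum_prod_arrow_prod fun l r => X l (x.1 l, r.1) (y.1 l, r.2) * R l (y.2 l, r.2) (x.2 l, r.1)

theorem localCost_sum [Fintype β] {ι : Type*} (s : Finset ι) (X : ι → Matrix (α × β) (α × β) ℂ)
    (ρ : Matrix (α × β) (α × β) ℂ) :
    localCost (∑ k ∈ s, X k) ρ = ∑ k ∈ s, localCost (X k) ρ := by
  ext x y
  simp only [localCost, Matrix.sum_apply, Matrix.of_apply, Finset.sum_mul]
  exact Finset.sum_comm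

/-- The transpose of the reduced state on `A`. -/
def reducedTranspose [Fintype β] (ρ : Matrix (α × β) (α × β) ℂ) : Matrix α α ℂ :=
  ∑ b, (ρ.submatrix (fun i => (i, b)) fun i => (i, b))ᵀ

/-- With `H = 1` the sum over `B` is a partial trace. This is what a copy on which the Hamiltonian
term acts trivially contributes to the cost. -/
theorem localCost_one [DecidableEq α] [Fintype β] [DecidableEq β]
    (ρ : Matrix (α × β) (α × β) ℂ) :
    localCost 1 ρ = (1 : Matrix α α ℂ) ⊗ₖ reducedTranspose ρ := by
  ext x y
  by_cases h : x.1 = y.1 <;>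
    simp [localCost, reducedTranspose, Matrix.one_apply, Matrix.sum_apply, h,
      Fintype.sum_prod_type]

theorem reducedTranspose_posSemidef [Fintype β] {ρ : Matrix (α × β) (α × β) ℂ}
    (hρ : ρ.PosSemidef) : (reducedTranspose ρ).PosSemidef :=
  posSemidef_sum _ fun _ _ => (hρ.submatrix _).transpose

theorem trace_reducedTranspose [Fintype α] [Fintype β] (ρ : Matrix (α × β) (α × β) ℂ) :
    (reducedTranspose ρ).trace = ρ.trace := by
  rw [reducedTranspose, Matrix.trace_sum]
  simp only [Matrix.trace, Matrix.diag_apply, Matrix.transpose_apply, Matrix.submatrix_apply,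
    Fintype.sum_prod_type]
  exact Finset.sum_comm

/-- The tensor product of operators on `n` copies of `A`. -/
def tensorFamily (Z : Fin n → Matrix α α ℂ) : Matrix (Fin n → α) (Fin n → α) ℂ :=
  Matrix.of fun p q => ∏ l, Z l (p l) (q l)

theorem trace_tensorFamily [Fintype α] (Z : Fin n → Matrix α α ℂ) :
    (tensorFamily Z).trace = ∏ l, (Z l).trace := by
  simp only [Matrix.trace, Matrix.diag_apply, tensorFamily, Matrix.of_apply]
  rw [Fintype.prod_sum]

theorem tensorCopies_one_kronecker [DecidableEq α] (Z : Fin n → Matrix β β ℂ) :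
    tensorCopies (fun l => (1 : Matrix α α ℂ) ⊗ₖ Z l) = 1 ⊗ₖ tensorFamily Z := by
  ext p q
  have h : ∏ l, (1 : Matrix α α ℂ) (p.1 l) (q.1 l) = (1 : Matrix (Fin n → α) _ ℂ) p.1 q.1 := by
    simp only [Matrix.one_apply, Finset.prod_ite_zero, Finset.prod_const_one, Finset.mem_univ,
      true_imp_iff, funext_iff]
  simp only [tensorCopies, Matrix.of_apply, kroneckerMap_apply, Finset.prod_mul_distrib, h,
    tensorFamily]

theorem localCost_sumHamiltonian_tensorPow [DecidableEq α] [Fintype β] [DecidableEq β]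
    (ρ H : Matrix (α × β) (α × β) ℂ) (n : ℕ) :
    localCost (sumHamiltonian H n) (tensorPow ρ n) =
      ∑ k : Fin n, tensorCopies (Function.update
        (fun _ => (1 : Matrix α α ℂ) ⊗ₖ reducedTranspose ρ) k (localCost H ρ)) := by
  rw [sumHamiltonian, localCost_sum]
  refine Finset.sum_congr rfl fun k _ => ?_
  rw [tensorPow, localCost_tensorCopies]
  congr 1
  ext1 l
  obtain rfl | hl := eq_or_ne l k
  · simp
  · simp [hl, localCost_one]

end TensorCopies

theorem theorem1 {α β : Type*} [Fintype α] [DecidableEq α] [Fintype β] [DecidableEq β]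
    (ρ H : Matrix (α × β) (α × β) ℂ) (h : IsCPTPLocalPassive ρ H) (n : ℕ) (hn : 0 < n) :
    IsCPTPLocalPassive (tensorPow ρ n) (sumHamiltonian H n) := by
  obtain ⟨Z, hZ, htr⟩ := h.exists_certificate
  set W := reducedTranspose ρ with hW
  -- The certificate mirrors the sum in `localCost_sumHamiltonian_tensorPow`, with `Z` for `C` and
  -- `W` for `1 ⊗ W`.
  refine isCPTPLocalPassive_of_certificate (tensorPow_isState h.isState n)
    (sumHamiltonian_isHermitian h.isHermitian n)
    (∑ k : Fin n, tensorFamily (Function.update (fun _ => W) k Z)) ?_ ?_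
  · have e (k : Fin n) : (1 : Matrix (Fin n → α) (Fin n → α) ℂ) ⊗ₖ
        tensorFamily (Function.update (fun _ => W) k Z) =
        tensorCopies (Function.update (fun _ => (1 : Matrix α α ℂ) ⊗ₖ W) k (1 ⊗ₖ Z)) := by
      rw [← tensorCopies_one_kronecker]
      congr 1
      ext1 l
      obtain rfl | hl := eq_or_ne l k
      · simp
      · simp [hl]
    have hsum : (1 : Matrix (Fin n → α) (Fin n → α) ℂ) ⊗ₖ
        (∑ k : Fin n, tensorFamily (Function.update (fun _ => W) k Z)) =
        ∑ k : Fin n, tensorCopies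
          (Function.update (fun _ => (1 : Matrix α α ℂ) ⊗ₖ W) k (1 ⊗ₖ Z)) := by
      simp_rw [← e]
      ext p q
      simp [Matrix.sum_apply, Finset.mul_sum]
    rw [localCost_sumHamiltonian_tensorPow, hsum, ← Finset.sum_sub_distrib]
    simp_rw [← hW, ← tensorCopies_update_sub]
    -- By linearity in slot `k`, each summand has `C - 1 ⊗ Z` there and `1 ⊗ W` elsewhere, all
    -- positive.
    refine posSemidef_sum _ fun k _ => tensorCopies_posSemidef fun l => ?_
    obtain rfl | hl := eq_or_ne l k
    · simpa using hZ
    · rw [Function.update_of_ne hl]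
      exact PosSemidef.one.kronecker (reducedTranspose_posSemidef h.isState.posSemidef)
  · have ht (k : Fin n) : (tensorFamily (Function.update (fun _ => W) k Z)).trace = Z.trace := by
      rw [trace_tensorFamily, Fintype.prod_eq_single k]
      · simp
      · intro l hl
        rw [Function.update_of_ne hl, hW, trace_reducedTranspose, h.isState.trace_eq_one]
    rw [energy_sumHamiltonian_tensorPow h.isState, Matrix.trace_sum]
    simp [ht, htr]
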